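/- Fix a prime number $p$; all rings are commutative with unit. A tower of rings $\{R_i,t_i\}_{i\ge 0}$ is a sequence of rings and ring homomorphisms $R_0\xrightarrow{t_0}R_1\xrightarrow{t_1}\cdots$; via the composites of the $t_j$, each $R_i$ is an $R_0$-algebra. Let $I_0\subset R_0$ be an ideal, write $\overline{R_i}=R_i/I_0R_i$, let $\overline{t_i}\colon\overline{R_i}\to\overline{R_{i+1}}$ be the map induced by $t_i$, and let $(R_i)_{I_0\text{-tor}}$ be the set of $x\in R_i$ such that for every $a\in I_0$ there is an integer $n>0$ with $a^nx=0$. The tower is called a *preperfectoid tower arising from* $(R_0,I_0)$ if the following hold. (a) $p\in I_0$. (b) For every $i\ge 0$, $\overline{t_i}$ is injective. (c) For every $i\ge 0$, the image of the Frobenius $x\mapsto x^p$ of $\overline{R_{i+1}}$ is contained in the image of $\overline{t_i}$. (Hence there is a unique ring homomorphism $F_i\colon\overline{R_{i+1}}\to\overline{R_i}$ with $\overline{t_i}(F_i(x))=x^p$ for all $x\in\overline{R_{i+1}}$.) (d) For every $i\ge 0$, $F_i$ is surjective. (f) $I_0$ is principal, and there is a principal ideal $I_1\subset R_1$ such that $I_1^p=I_0R_1$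 and $\ker F_i=I_1\overline{R_{i+1}}$ for every $i\ge 0$. (g) For every $i\ge 0$, $I_0\,(R_i)_{I_0\text{-tor}}=0$, and there is a bijection $(F_i)_{\mathrm{tor}}\colon(R_{i+1})_{I_0\text{-tor}}\to(R_i)_{I_0\text{-tor}}$ such that for every $x\in(R_{i+1})_{I_0\text{-tor}}$ the image of $(F_i)_{\mathrm{tor}}(x)$ in $\overline{R_i}$ equals $F_i$ of the image of $x$ in $\overline{R_{i+1}}$. The tower is *$I_0$-adically separated* if $\bigcap_{n>0}I_0^nR_i=0$ for every $i\ge 0$. **Statement.** Let $\{R_i,t_i\}_{i\ge 0}$ be an $I_0$-adically separated preperfectoid tower arising from $(R_0,I_0)$. Then for every $i\ge 0$ the map $t_i\colon R_i\to R_{i+1}$ is injective and the ring $R_i$ is reduced. -/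

import Mathlib

/-! A tower of rings is a family `R : ℕ → Type u` of commutative rings together with ring
homomorphisms `t i : R i →+* R (i + 1)`. -/

namespace RingTower

universe u

section Tower

variable {R : ℕ → Type u} [∀ i, CommRing (R i)]

/-- The transition map `R i → R j` for `i ≤ j`, the composite `t (j - 1) ∘ ⋯ ∘ t i`. -/
def trans (t : ∀ i, R i →+* R (i + 1)) {i j : ℕ} (h : i ≤ j) : R i →+* R j :=
  Nat.leRec (motive := fun k _ => R i →+* R k) (RingHom.id (R i))
    (fun k _ f => (t k).comp f) h

theorem trans_self (t : ∀ i, R i →+* R (i + 1)) (i : ℕ) :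
    trans t (le_refl i) = RingHom.id (R i) := by
  simp [trans]

theorem trans_succ (t : ∀ i, R i →+* R (i + 1)) {i j : ℕ} (h : i ≤ j) :
    trans t (Nat.le_succ_of_le h) = (t j).comp (trans t h) := by
  simp only [trans]
  exact Nat.leRec_succ _ _ _

/-- The ideal `I₀ R_i` of `R_i`. -/
def extIdeal (t : ∀ i, R i →+* R (i + 1)) (I₀ : Ideal (R 0)) (i : ℕ) : Ideal (R i) :=
  I₀.map (trans t (Nat.zero_le i))

theorem extIdeal_succ (t : ∀ i, R i →+* R (i + 1)) (I₀ : Ideal (R 0)) (i : ℕ) :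
    extIdeal t I₀ (i + 1) = (extIdeal t I₀ i).map (t i) := by
  rw [extIdeal, extIdeal, Ideal.map_map, ← trans_succ]

/-- The ring homomorphism `R_i / I₀ R_i → R_{i+1} / I₀ R_{i+1}` induced by `t i`. -/
def tbar (t : ∀ i, R i →+* R (i + 1)) (I₀ : Ideal (R 0)) (i : ℕ) :
    R i ⧸ extIdeal t I₀ i →+* R (i + 1) ⧸ extIdeal t I₀ (i + 1) :=
  Ideal.quotientMap _ (t i)
    (Ideal.map_le_iff_le_comap.mp (extIdeal_succ t I₀ i).ge)

/-- `t` is a purely inseparable tower arising from `(R 0, I₀)`. -/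
structure IsPurelyInseparable (p : ℕ) (t : ∀ i, R i →+* R (i + 1)) (I₀ : Ideal (R 0)) :
    Prop where
  /-- condition (a) -/
  p_mem : (p : R 0) ∈ I₀
  /-- condition (b) -/
  tbar_injective : ∀ i, Function.Injective (tbar t I₀ i)
  /-- condition (c): the image of the Frobenius lies in the image of the transition map -/
  pow_mem_range : ∀ i (x : R (i + 1) ⧸ extIdeal t I₀ (i + 1)), x ^ p ∈ (tbar t I₀ i).range

theorem IsPurelyInseparable.natCast_eq_zero {p : ℕ} {t : ∀ i, R i →+* R (i + 1)}
    {I₀ : Ideal (R 0)} (h : IsPurelyInseparable p t I₀) (i : ℕ) :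
    (p : R i ⧸ extIdeal t I₀ i) = 0 := by
  have h1 := Ideal.mem_map_of_mem (trans t (Nat.zero_le i)) h.p_mem
  rw [map_natCast] at h1
  rw [← map_natCast (Ideal.Quotient.mk (extIdeal t I₀ i))]
  exact Ideal.Quotient.eq_zero_iff_mem.mpr h1

/-- The `i`-th Frobenius projection `F_i : R_{i+1} / I₀ R_{i+1} → R_i / I₀ R_i`, the unique
ring homomorphism whose composite with `tbar` is the Frobenius `x ↦ x ^ p`. -/
noncomputable def frobProj {p : ℕ} [hp : Fact p.Prime] {t : ∀ i, R i →+* R (i + 1)}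
    {I₀ : Ideal (R 0)} (h : IsPurelyInseparable p t I₀) (i : ℕ) :
    R (i + 1) ⧸ extIdeal t I₀ (i + 1) →+* R i ⧸ extIdeal t I₀ i where
  toFun x := (h.pow_mem_range i x).choose
  map_one' := h.tbar_injective i <| by
    rw [(h.pow_mem_range i 1).choose_spec, one_pow, map_one]
  map_mul' x y := h.tbar_injective i <| by
    rw [(h.pow_mem_range i _).choose_spec, map_mul, (h.pow_mem_range i x).choose_spec,
      (h.pow_mem_range i y).choose_spec, mul_pow]
  map_zero' := h.tbar_injective i <| by
    rw [(h.pow_mem_range i 0).choose_spec, zero_pow hp.out.ne_zero, map_zero]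
  map_add' x y := h.tbar_injective i <| by
    rw [(h.pow_mem_range i _).choose_spec, map_add, (h.pow_mem_range i x).choose_spec,
      (h.pow_mem_range i y).choose_spec]
    obtain ⟨r, hr⟩ := exists_add_pow_prime_eq hp.out x y
    rw [hr, h.natCast_eq_zero]
    ring

theorem tbar_frobProj {p : ℕ} [Fact p.Prime] {t : ∀ i, R i →+* R (i + 1)}
    {I₀ : Ideal (R 0)} (h : IsPurelyInseparable p t I₀) (i : ℕ)
    (x : R (i + 1) ⧸ extIdeal t I₀ (i + 1)) :
    tbar t I₀ i (frobProj h i x) = x ^ p :=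
  (h.pow_mem_range i x).choose_spec

/-- The ideal of `I`-torsion elements of an `A`-algebra `f : A →+* B`: those `x` such that every
`a ∈ I` has a positive power annihilating `x`. -/
def torsionIdeal {A B : Type*} [CommRing A] [CommRing B] (f : A →+* B) (I : Ideal A) :
    Ideal B where
  carrier := {x | ∀ a ∈ I, ∃ n : ℕ, 0 < n ∧ f a ^ n * x = 0}
  zero_mem' := fun _ _ => ⟨1, one_pos, mul_zero _⟩
  add_mem' := by
    intro x y hx hy a ha
    obtain ⟨n, hn, hx⟩ := hx a ha
    obtain ⟨m, _, hy⟩ := hy a ha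
    refine ⟨n + m, by omega, ?_⟩
    have e : f a ^ (n + m) * (x + y)
        = f a ^ m * (f a ^ n * x) + f a ^ n * (f a ^ m * y) := by ring
    rw [e, hx, hy, mul_zero, mul_zero, add_zero]
  smul_mem' := by
    intro c x hx a ha
    obtain ⟨n, hn, hx⟩ := hx a ha
    refine ⟨n, hn, ?_⟩
    rw [smul_eq_mul, mul_left_comm, hx, mul_zero]

/-- The ideal of `I₀`-torsion elements of `R_i`. -/
def tor (t : ∀ i, R i →+* R (i + 1)) (I₀ : Ideal (R 0)) (i : ℕ) : Ideal (R i) :=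
  torsionIdeal (trans t (Nat.zero_le i)) I₀

/-- `t` is a preperfectoid tower arising from `(R 0, I₀)`. -/
structure IsPreperfectoid (p : ℕ) [Fact p.Prime] (t : ∀ i, R i →+* R (i + 1))
    (I₀ : Ideal (R 0)) : Prop extends IsPurelyInseparable p t I₀ where
  /-- condition (d) -/
  frobProj_surjective : ∀ i, Function.Surjective (frobProj toIsPurelyInseparable i)
  /-- condition (f), first half -/
  isPrincipal : I₀.IsPrincipal
  /-- condition (f), second half: existence of the first perfectoid pillar `I₁`, with
  `I₁ ^ p = I₀ R_1` and `ker F_i = I₁ (R_{i+1} / I₀ R_{i+1})` for all `i` -/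
  exists_pillar : ∃ I₁ : Ideal (R 1), I₁.IsPrincipal ∧ I₁ ^ p = extIdeal t I₀ 1 ∧
    ∀ i, RingHom.ker (frobProj toIsPurelyInseparable i) =
      I₁.map ((Ideal.Quotient.mk (extIdeal t I₀ (i + 1))).comp
        (trans t (Nat.le_add_left 1 i)))
  /-- condition (g), first half -/
  mul_tor : ∀ i, extIdeal t I₀ i * tor t I₀ i = ⊥
  /-- condition (g), second half -/
  exists_torsion_bijection : ∀ i, ∃ Ftor : tor t I₀ (i + 1) → tor t I₀ i,
    Function.Bijective Ftor ∧ ∀ x : tor t I₀ (i + 1),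
      frobProj toIsPurelyInseparable i (Ideal.Quotient.mk _ (x : R (i + 1))) =
        Ideal.Quotient.mk _ (Ftor x : R i)

/-- The tower is `I₀`-adically separated: every `R_i` is Hausdorff for the topology given by the
powers of `I₀ R_i`. -/
def IsSeparated (t : ∀ i, R i →+* R (i + 1)) (I₀ : Ideal (R 0)) : Prop :=
  ∀ i, IsHausdorff (extIdeal t I₀ i) (R i)

end Tower

end RingTower

namespace RingTower

universe u

section Preperfectoid

variable {R : ℕ → Type u} [∀ i, CommRing (R i)] {p : ℕ} [hp : Fact p.Prime]
  {t : ∀ i, R i →+* R (i + 1)} {I₀ : Ideal (R 0)}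

/-! Let `f` and `g` generate `I₀` and the pillar, so that `g ^ p` and `f` divide each other from
level 1 on, and let `T_i` be the torsion of `R_i`. By (g), `T_i` is killed by `f` and meets `f R_i`
only in 0, and `F_i` is injective on `T_{i+1}`. Hence a torsion element of `R_{i+1}` with zero
`p`-th power vanishes, and `g` kills `T_{i+1}`.

The core is `mem_tor_sup_of_map`: `R_i / (T_i + f R_i) → R_{i+1} / (T_{i+1} + f R_{i+1})` is
injective. So if `t i a` is torsion then `a = z + f y` with `z` torsion and `t i y` again torsion;
iterating, separatedness makes `a` torsion. If `t i a = 0`, then also `f ∣ a` by (b), so `a = 0`.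
Likewise, if `x ^ p` is torsion then `x = z + g y` with `y ^ p` torsion, so `x` is torsion, and `x ^
p = 0` forces `x = 0`. -/

theorem trans_succ_apply (t : ∀ i, R i →+* R (i + 1)) {i j : ℕ} (h : i ≤ j) (x : R i) :
    trans t (Nat.le_succ_of_le h) x = t j (trans t h x) := by
  rw [trans_succ, RingHom.comp_apply]

/-- The elements `f` and `g` generate `I₀` and a first perfectoid pillar of the tower. -/
structure IsPillarPair (h : IsPreperfectoid p t I₀) (f : R 0) (g : R 1) : Prop where
  eq_span : I₀ = Ideal.span {f}
  span_pow : Ideal.span {g} ^ p = extIdeal t I₀ 1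
  ker_eq : ∀ i, RingHom.ker (frobProj h.toIsPurelyInseparable i) =
    (Ideal.span {g}).map ((Ideal.Quotient.mk (extIdeal t I₀ (i + 1))).comp
      (trans t (Nat.le_add_left 1 i)))

theorem IsPreperfectoid.exists_isPillarPair (h : IsPreperfectoid p t I₀) :
    ∃ f g, IsPillarPair h f g := by
  obtain ⟨f, hf⟩ := h.isPrincipal
  obtain ⟨I₁, ⟨g, hg⟩, hpow, hker⟩ := h.exists_pillar
  rw [Ideal.submodule_span_eq] at hf hg
  subst hg
  exact ⟨f, g, hf, hpow, hker⟩

namespace IsPillarPair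

variable {h : IsPreperfectoid p t I₀} {f : R 0} {g : R 1}

/-! ### Generators, Frobenius kernels and torsion -/

theorem extIdeal_eq (hfg : IsPillarPair h f g) (i : ℕ) :
    extIdeal t I₀ i = Ideal.span {trans t (Nat.zero_le i) f} := by
  rw [extIdeal, hfg.eq_span, Ideal.map_span, Set.image_singleton]

theorem mem_extIdeal_iff (hfg : IsPillarPair h f g) {i : ℕ} {x : R i} :
    x ∈ extIdeal t I₀ i ↔ trans t (Nat.zero_le i) f ∣ x := by
  rw [hfg.extIdeal_eq, Ideal.mem_span_singleton]

theorem mk_eq_mk_iff (hfg : IsPillarPair h f g) {i : ℕ} {x y : R i} :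
    Ideal.Quotient.mk (extIdeal t I₀ i) x = Ideal.Quotient.mk (extIdeal t I₀ i) y ↔
      trans t (Nat.zero_le i) f ∣ x - y := by
  rw [Ideal.Quotient.eq, hfg.mem_extIdeal_iff]

theorem mem_tor_of_pow_mul_eq_zero (hfg : IsPillarPair h f g) {i n : ℕ} {x : R i} (hn : 0 < n)
    (hx : trans t (Nat.zero_le i) f ^ n * x = 0) : x ∈ tor t I₀ i := by
  intro a ha
  rw [hfg.eq_span, Ideal.mem_span_singleton] at ha
  obtain ⟨c, rfl⟩ := ha
  refine ⟨n, hn, ?_⟩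
  rw [map_mul, mul_pow, mul_right_comm, hx, zero_mul]

theorem mem_tor_iff (hfg : IsPillarPair h f g) {i : ℕ} {x : R i} :
    x ∈ tor t I₀ i ↔ trans t (Nat.zero_le i) f * x = 0 := by
  refine ⟨fun hx => ?_, fun hx =>
    hfg.mem_tor_of_pow_mul_eq_zero one_pos (by rwa [pow_one])⟩
  have := Ideal.mul_mem_mul (hfg.mem_extIdeal_iff.mpr (dvd_refl _)) hx
  rwa [h.mul_tor i, Ideal.mem_bot] at this

theorem eq_zero_of_mem_tor_of_dvd (hfg : IsPillarPair h f g) {i : ℕ} {x : R i}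
    (hx : x ∈ tor t I₀ i) (hdvd : trans t (Nat.zero_le i) f ∣ x) : x = 0 := by
  obtain ⟨y, rfl⟩ := hdvd
  rw [hfg.mem_tor_iff, ← mul_assoc, ← pow_two] at hx
  exact hfg.mem_tor_iff.mp (hfg.mem_tor_of_pow_mul_eq_zero two_pos hx)

theorem dvd_pow_and_pow_dvd (hfg : IsPillarPair h f g) (i : ℕ) :
    trans t (Nat.zero_le (i + 1)) f ∣ trans t (Nat.le_add_left 1 i) g ^ p ∧
      trans t (Nat.le_add_left 1 i) g ^ p ∣ trans t (Nat.zero_le (i + 1)) f := by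
  induction i with
  | zero =>
    have e := hfg.span_pow
    rw [hfg.extIdeal_eq, Ideal.span_singleton_pow] at e
    have e' : trans t (Nat.le_add_left 1 0) g = g := by
      change trans t (le_refl 1) g = g
      rw [trans_self, RingHom.id_apply]
    rw [e', ← Ideal.span_singleton_le_span_singleton, ← Ideal.span_singleton_le_span_singleton]
    exact ⟨e.le, e.ge⟩
  | succ i ih =>
    have e1 := trans_succ_apply t (Nat.zero_le (i + 1)) f
    have e2 := trans_succ_apply t (Nat.le_add_left 1 i) g
    rw [e1, e2, ← map_pow]
    exact ⟨map_dvd _ ih.1, map_dvd _ ih.2⟩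

theorem dvd_of_frobProj_eq_zero (hfg : IsPillarPair h f g) {i : ℕ} {x : R (i + 1)}
    (hx : frobProj h.toIsPurelyInseparable i (Ideal.Quotient.mk _ x) = 0) :
    trans t (Nat.le_add_left 1 i) g ∣ x := by
  rw [← RingHom.mem_ker, hfg.ker_eq, Ideal.map_span, Set.image_singleton,
    Ideal.mem_span_singleton] at hx
  obtain ⟨c, hc⟩ := hx
  obtain ⟨c, rfl⟩ := Ideal.Quotient.mk_surjective c
  rw [RingHom.comp_apply, ← map_mul, hfg.mk_eq_mk_iff] at hc
  have h1 := ((dvd_pow_self _ hp.out.ne_zero).trans (hfg.dvd_pow_and_pow_dvd i).2).trans hc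
  exact (dvd_sub_left (dvd_mul_right _ _)).mp h1

theorem frobProj_eq_zero_of_dvd (hfg : IsPillarPair h f g) {i : ℕ} {x : R (i + 1)}
    (hx : trans t (Nat.le_add_left 1 i) g ∣ x) :
    frobProj h.toIsPurelyInseparable i (Ideal.Quotient.mk _ x) = 0 := by
  rw [← RingHom.mem_ker, hfg.ker_eq, Ideal.map_span, Set.image_singleton,
    Ideal.mem_span_singleton, RingHom.comp_apply]
  exact map_dvd _ hx

theorem dvd_of_map_dvd (hfg : IsPillarPair h f g) {i : ℕ} {x : R i}
    (hx : trans t (Nat.zero_le (i + 1)) f ∣ t i x) : trans t (Nat.zero_le i) f ∣ x := by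
  rw [← hfg.mem_extIdeal_iff, ← Ideal.Quotient.eq_zero_iff_mem] at hx ⊢
  exact h.tbar_injective i (by rw [map_zero]; exact hx)

/-- The Frobenius projection sends classes of torsion elements to classes of torsion elements. -/
theorem exists_mem_tor_frobProj (h : IsPreperfectoid p t I₀) {i : ℕ} {z : R (i + 1)}
    (hz : z ∈ tor t I₀ (i + 1)) :
    ∃ w ∈ tor t I₀ i, frobProj h.toIsPurelyInseparable i (Ideal.Quotient.mk _ z) =
      Ideal.Quotient.mk _ w := by
  obtain ⟨F, -, hF⟩ := h.exists_torsion_bijection i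
  exact ⟨F ⟨z, hz⟩, (F ⟨z, hz⟩).2, hF ⟨z, hz⟩⟩

theorem exists_mem_tor_of_frobProj (h : IsPreperfectoid p t I₀) {i : ℕ} {w : R i}
    (hw : w ∈ tor t I₀ i) :
    ∃ z ∈ tor t I₀ (i + 1), frobProj h.toIsPurelyInseparable i (Ideal.Quotient.mk _ z) =
      Ideal.Quotient.mk _ w := by
  obtain ⟨F, hbij, hF⟩ := h.exists_torsion_bijection i
  obtain ⟨z, hz⟩ := hbij.2 ⟨w, hw⟩
  exact ⟨z, z.2, by rw [hF, hz]⟩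

theorem eq_zero_of_mem_tor_of_frobProj_eq_zero (hfg : IsPillarPair h f g) {i : ℕ}
    {z : R (i + 1)} (hz : z ∈ tor t I₀ (i + 1))
    (hFz : frobProj h.toIsPurelyInseparable i (Ideal.Quotient.mk _ z) = 0) : z = 0 := by
  obtain ⟨F, hbij, hF⟩ := h.exists_torsion_bijection i
  have key : ∀ x : tor t I₀ (i + 1),
      frobProj h.toIsPurelyInseparable i (Ideal.Quotient.mk _ (x : R (i + 1))) = 0 → F x = 0 := by
    intro x hx
    rw [hF, Ideal.Quotient.eq_zero_iff_mem, hfg.mem_extIdeal_iff] at hx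
    exact Subtype.ext (hfg.eq_zero_of_mem_tor_of_dvd (F x).2 hx)
  -- The bijection is not assumed additive, so its value at 0 must be derived.
  have h0 : F 0 = 0 := key 0 (by rw [ZeroMemClass.coe_zero, map_zero, map_zero])
  have := hbij.1 ((key ⟨z, hz⟩ hFz).trans h0.symm)
  exact congrArg Subtype.val this

theorem eq_zero_of_mem_tor_of_pow_eq_zero (hfg : IsPillarPair h f g) {i : ℕ}
    {z : R (i + 1)} (hz : z ∈ tor t I₀ (i + 1)) (hzp : z ^ p = 0) : z = 0 := by
  refine hfg.eq_zero_of_mem_tor_of_frobProj_eq_zero hz (h.tbar_injective i ?_)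
  rw [tbar_frobProj, ← map_pow, hzp, map_zero, map_zero]

/-- The `p`-th power of the product is a multiple of `f * z = 0`. -/
theorem mul_eq_zero_of_mem_tor (hfg : IsPillarPair h f g) {i : ℕ} {z : R (i + 1)}
    (hz : z ∈ tor t I₀ (i + 1)) : trans t (Nat.le_add_left 1 i) g * z = 0 := by
  refine hfg.eq_zero_of_mem_tor_of_pow_eq_zero (Ideal.mul_mem_left _ _ hz) ?_
  obtain ⟨v, hv⟩ := (hfg.dvd_pow_and_pow_dvd i).1
  obtain ⟨m, hm⟩ := Nat.exists_eq_succ_of_ne_zero hp.out.ne_zero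
  have hz' := hfg.mem_tor_iff.mp hz
  calc (trans t (Nat.le_add_left 1 i) g * z) ^ p
      = v * z ^ m * (trans t (Nat.zero_le (i + 1)) f * z) := by
        rw [mul_pow, hv, hm, Nat.succ_eq_add_one, pow_succ z m]; ring
    _ = 0 := by rw [hz', mul_zero]

theorem mem_tor_of_pow_mul (hfg : IsPillarPair h f g) {i n : ℕ} {x : R (i + 1)}
    (hx : trans t (Nat.le_add_left 1 i) g ^ n * x ∈ tor t I₀ (i + 1)) :
    x ∈ tor t I₀ (i + 1) := by
  obtain ⟨u, hu⟩ := (hfg.dvd_pow_and_pow_dvd i).2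
  have h1 := hfg.mul_eq_zero_of_mem_tor hx
  refine hfg.mem_tor_of_pow_mul_eq_zero (Nat.succ_pos n) ?_
  obtain ⟨d, hd⟩ : trans t (Nat.le_add_left 1 i) g ^ (n + 1) ∣
      trans t (Nat.zero_le (i + 1)) f ^ (n + 1) :=
    pow_dvd_pow_of_dvd ((dvd_pow_self _ hp.out.ne_zero).trans (hfg.dvd_pow_and_pow_dvd i).2) _
  rw [Nat.succ_eq_add_one, hd]
  linear_combination d * h1

/-! ### Descent along the transition maps modulo torsion -/

/-- Multiplying by `g ^ (p - 1)` kills `s`, since `p ≥ 2`, and turns divisibility by `g` into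
divisibility by `f`, which descends by (b). Cancelling `g ^ (p - 1)` costs only a torsion element.
-/
theorem mem_tor_sup_pillar_of_map (hfg : IsPillarPair h f g) {i : ℕ} {a : R (i + 1)}
    {s : R (i + 1 + 1)} (hs : s ∈ tor t I₀ (i + 1 + 1))
    (ha : trans t (Nat.le_add_left 1 (i + 1)) g ∣ t (i + 1) a - s) :
    ∃ z ∈ tor t I₀ (i + 1), trans t (Nat.le_add_left 1 i) g ∣ a - z := by
  obtain ⟨c, hc⟩ := ha
  obtain ⟨m, hm⟩ := Nat.exists_eq_add_of_le' hp.out.two_le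
  have hgs := hfg.mul_eq_zero_of_mem_tor hs
  have e2 : trans t (Nat.le_add_left 1 (i + 1)) g = t (i + 1) (trans t (Nat.le_add_left 1 i) g) :=
    trans_succ_apply t (Nat.le_add_left 1 i) g
  have h1 : trans t (Nat.zero_le (i + 1)) f ∣ trans t (Nat.le_add_left 1 i) g ^ (m + 1) * a := by
    refine hfg.dvd_of_map_dvd ((hfg.dvd_pow_and_pow_dvd (i + 1)).1.trans ⟨c, ?_⟩)
    rw [map_mul, map_pow, ← e2, hm]
    linear_combination trans t (Nat.le_add_left 1 (i + 1)) g ^ (m + 1) * hc +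
      trans t (Nat.le_add_left 1 (i + 1)) g ^ m * hgs
  obtain ⟨d, hd⟩ := (hfg.dvd_pow_and_pow_dvd i).2.trans h1
  refine ⟨a - trans t (Nat.le_add_left 1 i) g * d, hfg.mem_tor_of_pow_mul (n := m + 1) ?_,
    ⟨d, by ring⟩⟩
  convert (tor t I₀ (i + 1)).zero_mem using 1
  rw [hm] at hd
  linear_combination hd

theorem frobProj_map (h : IsPreperfectoid p t I₀) (i : ℕ) (b : R (i + 1)) :
    frobProj h.toIsPurelyInseparable (i + 1) (Ideal.Quotient.mk _ (t (i + 1) b)) =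
      tbar t I₀ i (frobProj h.toIsPurelyInseparable i (Ideal.Quotient.mk _ b)) := by
  apply h.tbar_injective (i + 1)
  rw [tbar_frobProj, tbar_frobProj, ← map_pow, ← map_pow, ← map_pow]
  rfl

/-- The Frobenius projections commute with the transition maps and carry the question from `f` to
`g` one level higher, where the previous descent applies. -/
theorem mem_tor_sup_of_map (hfg : IsPillarPair h f g) {i : ℕ} {a : R i}
    {s : R (i + 1)} (hs : s ∈ tor t I₀ (i + 1))
    (ha : trans t (Nat.zero_le (i + 1)) f ∣ t i a - s) :
    ∃ z ∈ tor t I₀ i, trans t (Nat.zero_le i) f ∣ a - z := by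
  obtain ⟨b, hb⟩ := h.frobProj_surjective i (Ideal.Quotient.mk _ a)
  obtain ⟨b, rfl⟩ := Ideal.Quotient.mk_surjective b
  obtain ⟨s', hs', hFs'⟩ := exists_mem_tor_of_frobProj h hs
  have h1 : frobProj h.toIsPurelyInseparable (i + 1)
      (Ideal.Quotient.mk _ (t (i + 1) b - s')) = 0 := by
    rw [map_sub, map_sub, frobProj_map h, hFs', hb, sub_eq_zero]
    exact hfg.mk_eq_mk_iff.mpr ha
  obtain ⟨z, hz, hbz⟩ := hfg.mem_tor_sup_pillar_of_map hs' (hfg.dvd_of_frobProj_eq_zero h1)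
  obtain ⟨w, hw, hFw⟩ := exists_mem_tor_frobProj h hz
  refine ⟨w, hw, hfg.mk_eq_mk_iff.mp ?_⟩
  rw [← hb, ← hFw, ← sub_eq_zero, ← map_sub, ← map_sub]
  exact hfg.frobProj_eq_zero_of_dvd hbz

/-! ### Separatedness, injectivity and reducedness -/

theorem eq_zero_of_forall_pow_dvd (hfg : IsPillarPair h f g) (hsep : IsSeparated t I₀) {i : ℕ}
    {x : R i} (hx : ∀ n : ℕ, trans t (Nat.zero_le i) f ^ n ∣ x) : x = 0 := by
  refine (hsep i).haus x fun n => ?_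
  rw [SModEq.zero, smul_eq_mul, Ideal.mul_top, hfg.extIdeal_eq, Ideal.span_singleton_pow,
    Ideal.mem_span_singleton]
  exact hx n

/-- If `c * z = 0` for `z ∈ J` and every element of `P` lies in `J + c P`, then every element of
`P` lies in `J` up to elements divisible by arbitrary powers of `c`. -/
theorem exists_forall_pow_dvd_sub {A : Type*} [CommRing A] (c : A) (J P : A → Prop)
    (hJ : ∀ z, J z → c * z = 0) (hP : ∀ x, P x → ∃ z, J z ∧ ∃ y, P y ∧ x - z = c * y)
    (x : A) (hx : P x) : ∃ z, J z ∧ ∀ n : ℕ, c ^ n ∣ x - z := by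
  -- Multiplication by `c` removes each new error in `J`, so the first `z` serves for every `n`.
  have key : ∀ n : ℕ, ∀ y, P y → c ^ n ∣ c * y := by
    intro n
    induction n with
    | zero => intro y _; rw [pow_zero]; exact one_dvd _
    | succ n ih =>
      intro y hy
      obtain ⟨z, hz, w, hw, e⟩ := hP y hy
      have e' : c * y = c * (c * w) := by linear_combination c * e + hJ z hz
      rw [e', pow_succ']
      exact mul_dvd_mul_left _ (ih w hw)
  obtain ⟨z, hz, y, hy, e⟩ := hP x hx
  exact ⟨z, hz, fun n => e ▸ key n y hy⟩

theorem mem_tor_of_map_mem_tor (hfg : IsPillarPair h f g) (hsep : IsSeparated t I₀) {i : ℕ}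
    {a : R i} (ha : t i a ∈ tor t I₀ (i + 1)) : a ∈ tor t I₀ i := by
  obtain ⟨z, hz, hd⟩ := exists_forall_pow_dvd_sub (trans t (Nat.zero_le i) f)
    (· ∈ tor t I₀ i) (t i · ∈ tor t I₀ (i + 1)) (fun z => hfg.mem_tor_iff.mp) (fun x hx => by
      obtain ⟨z, hz, y, e⟩ := hfg.mem_tor_sup_of_map hx (by rw [sub_self]; exact dvd_zero _)
      -- Since `f` kills both `x` and `z` in `R_{i+1}`, applying `t i` to `f * (x - z) = f ^ 2 * y`
      -- shows that `f ^ 2` kills `t i y`.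
      refine ⟨z, hz, y, hfg.mem_tor_of_pow_mul_eq_zero two_pos ?_, e⟩
      have e1 : trans t (Nat.zero_le (i + 1)) f = t i (trans t (Nat.zero_le i) f) :=
        trans_succ_apply t (Nat.zero_le i) f
      have e2 := congrArg (t i) (hfg.mem_tor_iff.mp hz)
      have e3 := congrArg (t i) e
      have e4 := hfg.mem_tor_iff.mp hx
      simp only [map_mul, map_sub, map_zero, ← e1] at e2 e3
      linear_combination e4 - e2 - trans t (Nat.zero_le (i + 1)) f * e3) a ha
  rwa [← sub_eq_zero.mp (hfg.eq_zero_of_forall_pow_dvd hsep hd)] at hz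

theorem map_injective (hfg : IsPillarPair h f g) (hsep : IsSeparated t I₀) (i : ℕ) :
    Function.Injective (t i) := by
  rw [injective_iff_map_eq_zero]
  intro a ha
  refine hfg.eq_zero_of_mem_tor_of_dvd
    (hfg.mem_tor_of_map_mem_tor hsep (by rw [ha]; exact zero_mem _)) (hfg.dvd_of_map_dvd ?_)
  rw [ha]
  exact dvd_zero _

/-- A lift `b` of `F_i x` maps to `x ^ p` modulo `f`, so `b` lies in `T_i + f R_i`; pulling this
back along `F_i`, whose kernel is generated by `g`, gives the claim. -/
theorem exists_mem_tor_dvd_sub_of_pow_mem_tor (hfg : IsPillarPair h f g) {i : ℕ}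
    {x : R (i + 1)} (hx : x ^ p ∈ tor t I₀ (i + 1)) :
    ∃ z ∈ tor t I₀ (i + 1), trans t (Nat.le_add_left 1 i) g ∣ x - z := by
  obtain ⟨b, hb⟩ := Ideal.Quotient.mk_surjective
    (frobProj h.toIsPurelyInseparable i (Ideal.Quotient.mk _ x))
  have h1 : Ideal.Quotient.mk (extIdeal t I₀ (i + 1)) (t i b) = Ideal.Quotient.mk _ (x ^ p) := by
    have e := tbar_frobProj h.toIsPurelyInseparable i (Ideal.Quotient.mk _ x)
    rw [← hb, ← map_pow] at e
    exact e
  obtain ⟨w, hw, hbw⟩ := hfg.mem_tor_sup_of_map hx (hfg.mk_eq_mk_iff.mp h1)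
  obtain ⟨z, hz, hzw⟩ := exists_mem_tor_of_frobProj h hw
  refine ⟨z, hz, hfg.dvd_of_frobProj_eq_zero ?_⟩
  rw [map_sub, map_sub, hzw, ← hb, sub_eq_zero]
  exact hfg.mk_eq_mk_iff.mpr hbw

theorem mem_tor_of_pow_mem_tor (hfg : IsPillarPair h f g) (hsep : IsSeparated t I₀) {i : ℕ}
    {x : R (i + 1)} (hx : x ^ p ∈ tor t I₀ (i + 1)) : x ∈ tor t I₀ (i + 1) := by
  obtain ⟨z, hz, hd⟩ := exists_forall_pow_dvd_sub (trans t (Nat.le_add_left 1 i) g)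
    (· ∈ tor t I₀ (i + 1)) (· ^ p ∈ tor t I₀ (i + 1))
    (fun z => hfg.mul_eq_zero_of_mem_tor) (fun x hx => by
      obtain ⟨z, hz, y, e⟩ := hfg.exists_mem_tor_dvd_sub_of_pow_mem_tor hx
      -- As `g * z = 0`, one has `g * x = g ^ 2 * y`, whose `p`-th power is `g ^ p * x ^ p = g ^ (2
      -- * p) * y ^ p`.
      refine ⟨z, hz, y, hfg.mem_tor_of_pow_mul (n := p + p) ?_, e⟩
      have e1 : trans t (Nat.le_add_left 1 i) g * x =
          trans t (Nat.le_add_left 1 i) g * (trans t (Nat.le_add_left 1 i) g * y) := by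
        linear_combination trans t (Nat.le_add_left 1 i) g * e + hfg.mul_eq_zero_of_mem_tor hz
      have e2 := congrArg (· ^ p) e1
      simp only [mul_pow] at e2
      rw [pow_add, mul_assoc, ← e2]
      exact Ideal.mul_mem_left _ _ hx) x hx
  have hd' : ∀ n : ℕ, trans t (Nat.zero_le (i + 1)) f ^ n ∣ x - z := fun n => by
    refine (pow_dvd_pow_of_dvd (hfg.dvd_pow_and_pow_dvd i).1 n).trans ?_
    rw [← pow_mul]
    exact hd _
  rwa [← sub_eq_zero.mp (hfg.eq_zero_of_forall_pow_dvd hsep hd')] at hz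

theorem isReduced_succ (hfg : IsPillarPair h f g) (hsep : IsSeparated t I₀) (i : ℕ) :
    IsReduced (R (i + 1)) := by
  refine (isReduced_iff_pow_one_lt p hp.out.one_lt).mpr fun x hx => ?_
  exact hfg.eq_zero_of_mem_tor_of_pow_eq_zero
    (hfg.mem_tor_of_pow_mem_tor hsep (by rw [hx]; exact zero_mem _)) hx

end IsPillarPair

end Preperfectoid

end RingTower

theorem mainTheorem4 (p : ℕ) [Fact p.Prime] {R : ℕ → Type*} [∀ i, CommRing (R i)]
    (t : ∀ i, R i →+* R (i + 1)) (I₀ : Ideal (R 0))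
    (hR : RingTower.IsPreperfectoid p t I₀) (hsep : RingTower.IsSeparated t I₀) :
    (∀ i, Function.Injective (t i)) ∧ ∀ i, IsReduced (R i) := by
  obtain ⟨f, g, hfg⟩ := hR.exists_isPillarPair
  refine ⟨hfg.map_injective hsep, fun i => ?_⟩
  -- The pillar exists only from level 1 on, so `R i` inherits reducedness from `R (i + 1)`, which
  -- also covers `i = 0`.
  have := hfg.isReduced_succ hsep i
  exact isReduced_of_injective (t i) (hfg.map_injective hsep i)
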